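/- Let $n\ge 3$, $Q=\{0,\dots,n-1\}$ and $Q_M=\{1,\dots,n-3\}$. Write transformations $t\colon Q\to Q$ on the right ($qt$ is the image of $q$), and compose them as $q(st)=(qs)t$. Let $$\mathbf B_{\mathrm{bf}}(n)=\{t\colon Q\to Q \mid 0\notin Qt,\ (n-1)t=(n-2)t=n-1,\text{ and for all } j\ge 1:\ 0t^j=n-1 \text{ or } 0t^j\ne qt^j \text{ for all } 0<q<n-1\},$$ $$\mathbf W^{\ge 6}_{\mathrm{bf}}(n)=\{t\in\mathbf B_{\mathrm{bf}}(n)\mid 0t\in\{n-2,n-1\},\text{ or } 0t\in Q_M \text{ and } qt\in\{n-2,n-1\} \text{ for all } q\in Q_M\},$$ $$\mathbf W^{\le 5}_{\mathrm{bf}}(n)=\{t\in\mathbf B_{\mathrm{bf}}(n)\mid \text{for all distinct } p,q\in Q_M:\ pt=qt=n-1 \text{ or } pt\ne qt\}.$$ A language is bifix-free if no word in it is a proper prefix or a proper suffix of another word in it. The transition semigroup of a complete deterministic finite automaton (DFA) is the semigroup of transformations of its state set generated by the transformations induced by the letters. Let $\mathcal C_n$ be the class of minimal complete DFAs with exactly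 $n$ states, over an arbitrary finite alphabet, that accept a bifix-free language. A standard naming of a DFA in $\mathcal C_n$ is a bijection of its state set with $Q$ under which $0$ is the initial state, $n-2$ is the only final state, and $n-1$ is the empty state (no word is accepted from it). Say that a set $W$ of transformations of $Q$ is the unique largest transition semigroup for $n$ if: 1. $W$ is the transition semigroup of some DFA in $\mathcal C_n$ with state set $Q$, initial state $0$, set of final states $\{n-2\}$ and empty state $n-1$; 2. every DFA in $\mathcal C_n$ has a standard naming, and its transition semigroup has at most $|W|$ elements; 3. if the transition semigroup of a DFA in $\mathcal C_n$ has exactly $|W|$ elements, then it becomes equal to $W$ under every standard naming of the states. **Theorem.** - For $n\in\{6,7\}$, $\mathbf W^{\ge 6}_{\mathrm{bf}}(n)$ is the unique largest transition semigroup for $n$. - For $n=5$, $\mathbf W^{\le 5}_{\mathrm{bf}}(5)$ is the unique largest transition semigroup for $n$. - For $n\in\{3,4\}$, $\mathbf W^{\ge 6}_{\mathrm{bf}}(n)=\mathbf W^{\le 5}_{\mathrm{bf}}(n)$, and this is the unique largest transition semigroup for $n$. -/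

import Mathlib

universe u v

namespace BifixFree

/-! ### Bifix-free languages -/

/-- No word of `L` is a proper prefix of another word of `L`. -/
def IsPrefixFree {α : Type u} (L : Language α) : Prop :=
  ∀ x ∈ L, ∀ y ∈ L, x <+: y → x = y

/-- No word of `L` is a proper suffix of another word of `L`. -/
def IsSuffixFree {α : Type u} (L : Language α) : Prop :=
  ∀ x ∈ L, ∀ y ∈ L, x <:+ y → x = y

/-- `L` is both prefix-free and suffix-free. -/
def IsBifixFree {α : Type u} (L : Language α) : Prop :=
  IsPrefixFree L ∧ IsSuffixFree L

/-! ### Minimal automata and transition semigroups -/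

/-- The (complete) finite automaton `M` has the least number of states among all
complete finite automata that accept the same language. -/
def IsMinimal {α : Type u} {σ : Type v} (M : DFA α σ) : Prop :=
  Finite σ ∧ ∀ (m : ℕ) (N : DFA α (Fin m)), N.accepts = M.accepts → Nat.card σ ≤ m

/-- The transformation of the state set induced by a letter. -/
def letterMap {α : Type u} {σ : Type v} (M : DFA α σ) (a : α) : Function.End σ :=
  fun q => M.step q a

/-- The transition semigroup of `M`: the semigroup of transformations (under composition)
generated by the transformations induced by the letters. -/
def transitionSemigroup {α : Type u} {σ : Type v} (M : DFA α σ) :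
    Subsemigroup (Function.End σ) :=
  Subsemigroup.closure (Set.range (letterMap M))

/-- The underlying set of transformations of the transition semigroup. -/
def transitions {α : Type u} {σ : Type v} (M : DFA α σ) : Set (σ → σ) :=
  {t | t ∈ transitionSemigroup M}

/-! ### States `0, …, n - 1` -/

/-- The state `n - 2`. -/
def fin (n : ℕ) [NeZero n] : Fin n := Fin.ofNat n (n - 2)

/-- The state `n - 1`. -/
def emp (n : ℕ) [NeZero n] : Fin n := Fin.ofNat n (n - 1)

/-- The set `Q_M = {1, …, n - 3}` of middle states. -/
def middle (n : ℕ) : Set (Fin n) := {q | 1 ≤ (q : ℕ) ∧ (q : ℕ) ≤ n - 3}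

/-- The bijection `e` names the states of `M` by `0, …, n - 1` such that `0` is the initial
state, `n - 2` is the only final state, and `n - 1` is an empty state (a state from
which no word is accepted). -/
structure IsStandardNaming {α : Type u} {σ : Type v} (M : DFA α σ) (n : ℕ) [NeZero n]
    (e : σ ≃ Fin n) : Prop where
  start : e M.start = 0
  accept : e '' M.accept = {fin n}
  empty : M.acceptsFrom (e.symm (emp n)) = 0

/-! ### The sets of transformations -/

/-- The set `B_bf(n)`. -/
def Bbf (n : ℕ) [NeZero n] : Set (Fin n → Fin n) :=
  {t | 0 ∉ Set.range t ∧ t (emp n) = emp n ∧ t (fin n) = emp n ∧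
    ∀ j : ℕ, 1 ≤ j → t^[j] 0 = emp n ∨
      ∀ q : Fin n, 0 < (q : ℕ) → (q : ℕ) < n - 1 → t^[j] 0 ≠ t^[j] q}

/-- The set `W^{≥6}_bf(n)`. -/
def Wge6 (n : ℕ) [NeZero n] : Set (Fin n → Fin n) :=
  {t | t ∈ Bbf n ∧
    ((t 0 = fin n ∨ t 0 = emp n) ∨
      (t 0 ∈ middle n ∧ ∀ q ∈ middle n, t q = fin n ∨ t q = emp n))}

/-- The set `W^{≤5}_bf(n)`. -/
def Wle5 (n : ℕ) [NeZero n] : Set (Fin n → Fin n) :=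
  {t | t ∈ Bbf n ∧
    ∀ p ∈ middle n, ∀ q ∈ middle n, p ≠ q →
      (t p = emp n ∧ t q = emp n) ∨ t p ≠ t q}

/-! ### Being the unique largest transition semigroup -/

/-- `W` is the unique largest transition semigroup of a minimal `n`-state automaton of a
bifix-free language (for `n ≥ 3`), up to naming the states in the standard way. -/
structure IsUniqueLargest (n : ℕ) [NeZero n] (W : Set (Fin n → Fin n)) : Prop where
  /-- `W` is such a semigroup. -/
  attained : ∃ (k : ℕ) (M : DFA (Fin k) (Fin n)),
    IsMinimal M ∧ IsBifixFree M.accepts ∧ IsStandardNaming M n (Equiv.refl (Fin n)) ∧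
      transitions M = W
  /-- The states can always be named in the standard way. -/
  naming : ∀ (α : Type u) (σ : Type v) [Finite α] (M : DFA α σ),
    IsMinimal M → IsBifixFree M.accepts → Nat.card σ = n →
      ∃ e : σ ≃ Fin n, IsStandardNaming M n e
  /-- No such semigroup has more elements than `W`. -/
  largest : ∀ (α : Type u) (σ : Type v) [Finite α] (M : DFA α σ),
    IsMinimal M → IsBifixFree M.accepts → Nat.card σ = n →
      (transitions M).ncard ≤ W.ncard
  /-- Every such semigroup with as many elements as `W` is `W`, in each standard naming of
  the states. -/
  unique : ∀ (α : Type u) (σ : Type v) [Finite α] (M : DFA α σ),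
    IsMinimal M → IsBifixFree M.accepts → Nat.card σ = n →
      (transitions M).ncard = W.ncard →
        ∀ e : σ ≃ Fin n, IsStandardNaming M n e → e.conj '' transitions M = W

end BifixFree

/-!
Let `T` be the transition semigroup of a minimal automaton of a bifix-free language, with the
states named in the standard way. Minimality means that all states are reachable and pairwise
distinguishable (`IsMinimal.reachable`, `IsMinimal.acceptsFrom_injective`), and together with
bifix-freeness this gives the standard naming (`exists_isStandardNaming`) and the inclusion
`T ⊆ Bbf n` (`conj_transitions_subset_Bbf`). Conversely, a subset of `Bbf n` that is closed under
composition and contains enough transformations with a single non-empty value is such a semigroup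
(`exists_automaton_of_comp_mem`). What remains is a question about semigroups `T ⊆ Bbf n`.

Two middle states collide in `T` if some element of `T` maps the initial state to one of them and
a middle state to the other. If `t` does this and `s ∈ T` identifies the two states, then `s ∘ t`
identifies the initial state with a middle state, so by the definition of `Bbf n` the common value
is the empty state (`Colliding.eq_emp`). Hence `T ⊆ Wge6 n` if no states collide, and `T ⊆ Wle5 n`
if all middle states do. With at most one middle state, `Bbf n`, `Wge6 n` and `Wle5 n` coincide.

For `n = 5` there is only one pair of middle states. Either it collides, or `T` has at most 33
elements, whereas `Wle5 5` has at least 34. For `n = 6` and `n = 7`, suppose that some pair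
collides. For each graph of colliding pairs there is an upper bound for `T` (`ncard_le_bound`): an
element of `T` identifies no colliding states outside the empty state, and if it maps `0` to a
middle state `z`, then it maps each middle state to a neighbour of `z` or to one of the last two
states. For every graph with an edge, evaluating the bound gives less than the size of `Wge6 n`
(`bound_graph_three_lt`, `bound_graph_four_lt`), which is at least
`(n-1)^(n-3) + (n-2)^(n-3) + (n-3) 2^(n-3)`.
-/

namespace BifixFree

/-! ### Minimal automata -/

section Automata

variable {α : Type u} {σ : Type v} {M : DFA α σ}

/-- The left quotients of a language are the states of an automaton that accepts it. -/
theorem IsMinimal.card_le_card_leftQuotient (hM : IsMinimal M) :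
    Nat.card σ ≤ Nat.card (Set.range M.accepts.leftQuotient) := by
  have := hM.1
  have hfin : Finite (Set.range M.accepts.leftQuotient) := by
    rw [Language.leftQuotient_accepts]
    exact ((Set.finite_range M.acceptsFrom).subset (Set.range_comp_subset_range _ _)).to_subtype
  refine hM.2 _ (DFA.reindex (Finite.equivFin _) M.accepts.toDFA) ?_
  rw [DFA.accepts_reindex, Language.accepts_toDFA]

/-- The left quotients are the languages accepted from the reachable states. Both
reachability and distinguishability follow by counting. -/
theorem IsMinimal.card_le_ncard_range_eval (hM : IsMinimal M) :
    Nat.card σ ≤ (M.acceptsFrom '' Set.range M.eval).ncard := by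
  rw [← Set.range_comp, ← Language.leftQuotient_accepts]
  exact hM.card_le_card_leftQuotient

theorem IsMinimal.reachable (hM : IsMinimal M) (q : σ) : ∃ w, M.eval w = q := by
  have := hM.1
  have h : Set.range M.eval = Set.univ := by
    apply Set.eq_of_subset_of_ncard_le (Set.subset_univ _)
    rw [Set.ncard_univ]
    exact hM.card_le_ncard_range_eval.trans (Set.ncard_image_le (Set.toFinite _))
  exact Set.range_eq_univ.1 h q

theorem IsMinimal.acceptsFrom_injective (hM : IsMinimal M) :
    Function.Injective M.acceptsFrom := by
  have := hM.1
  rw [← Set.injOn_univ]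
  refine Set.injOn_of_ncard_image_eq (le_antisymm (Set.ncard_image_le (Set.toFinite _)) ?_)
  rw [Set.ncard_univ]
  exact hM.card_le_ncard_range_eval.trans
    (Set.ncard_le_ncard (Set.image_mono (Set.subset_univ _)) (Set.toFinite _))

/-- Reachability and distinguishability of all states suffice for minimality. -/
theorem isMinimal_of_reachable [Finite σ] (hr : ∀ q, ∃ w, M.eval w = q)
    (hd : Function.Injective M.acceptsFrom) : IsMinimal M := by
  refine ⟨‹_›, fun m N hN => ?_⟩
  choose w hw using hr
  have hinj : Function.Injective fun q => N.eval (w q) := by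
    intro p q hpq
    have h : ∀ q, M.acceptsFrom q = N.acceptsFrom (N.eval (w q)) := fun q => by
      rw [← Language.leftQuotient_accepts_apply, hN, Language.leftQuotient_accepts_apply, hw]
    exact hd (by rw [h p, h q]; exact congrArg _ hpq)
  simpa using Nat.card_le_card_of_injective _ hinj

theorem append_mem_acceptsFrom {q : σ} {x y : List α} :
    x ++ y ∈ M.acceptsFrom q ↔ y ∈ M.acceptsFrom (M.evalFrom q x) := by
  rw [DFA.mem_acceptsFrom, DFA.mem_acceptsFrom, DFA.evalFrom_of_append]

theorem append_mem_accepts {x y : List α} :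
    x ++ y ∈ M.accepts ↔ y ∈ M.acceptsFrom (M.eval x) :=
  append_mem_acceptsFrom

/-- Words lead from empty states to empty states. -/
theorem acceptsFrom_evalFrom_eq_zero {q : σ} (hq : M.acceptsFrom q = 0) (x : List α) :
    M.acceptsFrom (M.evalFrom q x) = 0 := by
  ext y
  rw [← append_mem_acceptsFrom, hq]
  exact Iff.rfl

/-- In the minimal automaton of a prefix-free language, a non-empty word leads from a final
state to an empty one. -/
theorem acceptsFrom_evalFrom_accept (hM : IsMinimal M) (hL : IsPrefixFree M.accepts) {f : σ}
    (hf : f ∈ M.accept) {x : List α} (hx : x ≠ []) : M.acceptsFrom (M.evalFrom f x) = 0 := by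
  obtain ⟨w, rfl⟩ := hM.reachable f
  ext y
  rw [← append_mem_acceptsFrom, ← append_mem_accepts]
  refine ⟨fun h => hx ?_, fun h => h.elim⟩
  have := hL w hf _ h (List.prefix_append _ _)
  simp at this
  exact this.1

theorem exists_mem_accept (hM : IsMinimal M) (hcard : 3 ≤ Nat.card σ) : ∃ f, f ∈ M.accept := by
  by_contra! h
  have : Subsingleton σ := ⟨fun p q => hM.acceptsFrom_injective <| by
    ext x
    simp [DFA.mem_acceptsFrom, h]⟩
  have := Finite.card_le_one_iff_subsingleton.2 this
  omega

theorem mem_accept_unique (hM : IsMinimal M) (hL : IsPrefixFree M.accepts) {f g : σ}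
    (hf : f ∈ M.accept) (hg : g ∈ M.accept) : f = g := by
  refine hM.acceptsFrom_injective ?_
  have key : ∀ {f : σ}, f ∈ M.accept → ∀ x, x ∈ M.acceptsFrom f ↔ x = [] := by
    intro f hf x
    refine ⟨fun hx => ?_, fun hx => hx ▸ hf⟩
    by_contra hne
    have h := acceptsFrom_evalFrom_accept hM hL hf hne
    have : [] ∈ M.acceptsFrom (M.evalFrom f x) := hx
    rw [h] at this
    exact this
  ext x
  rw [key hf, key hg]

theorem exists_acceptsFrom_eq_zero (hM : IsMinimal M) (hL : IsPrefixFree M.accepts)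
    (hcard : 3 ≤ Nat.card σ) : ∃ q, M.acceptsFrom q = 0 := by
  obtain ⟨f, hf⟩ := exists_mem_accept hM hcard
  rcases isEmpty_or_nonempty α with hα | ⟨⟨a⟩⟩
  · have : Subsingleton σ := by
      refine subsingleton_of_forall_eq M.start fun q => ?_
      obtain ⟨w, rfl⟩ := hM.reachable q
      rw [Subsingleton.elim w []]
      rfl
    have := Finite.card_le_one_iff_subsingleton.2 this
    omega
  · exact ⟨_, acceptsFrom_evalFrom_accept hM hL hf (List.cons_ne_nil a [])⟩

theorem start_notMem_accept (hM : IsMinimal M) (hL : IsPrefixFree M.accepts)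
    (hcard : 3 ≤ Nat.card σ) : M.start ∉ M.accept := by
  intro hs
  obtain ⟨e, he⟩ := exists_acceptsFrom_eq_zero hM hL hcard
  have h : (Set.univ : Set σ) ⊆ {M.start, e} := by
    intro q _
    obtain ⟨w, rfl⟩ := hM.reachable q
    by_cases hw : w = []
    · exact Or.inl (hw ▸ rfl)
    · refine Or.inr (hM.acceptsFrom_injective ?_)
      rw [he]
      exact acceptsFrom_evalFrom_accept hM hL hs hw
  have h1 := Set.ncard_le_ncard h (Set.toFinite _)
  rw [Set.ncard_univ] at h1
  have h2 := Set.ncard_insert_le M.start {e}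
  rw [Set.ncard_singleton] at h2
  omega

theorem acceptsFrom_start_ne_zero (hM : IsMinimal M) (hcard : 3 ≤ Nat.card σ) :
    M.acceptsFrom M.start ≠ 0 := by
  intro h
  obtain ⟨f, hf⟩ := exists_mem_accept hM hcard
  obtain ⟨w, rfl⟩ := hM.reachable f
  have : w ∈ M.acceptsFrom M.start := hf
  rw [h] at this
  exact this

end Automata

/-! ### Standard namings -/

section Naming

variable {n : ℕ} [NeZero n]

theorem val_fin : (fin n : ℕ) = n - 2 :=
  Nat.mod_eq_of_lt (by have := NeZero.pos n; omega)

theorem val_emp : (emp n : ℕ) = n - 1 :=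
  Nat.mod_eq_of_lt (by have := NeZero.pos n; omega)

theorem fin_ne_emp (hn : 3 ≤ n) : fin n ≠ emp n := by
  rw [Ne, Fin.ext_iff, val_fin, val_emp]; omega

theorem fin_ne_zero (hn : 3 ≤ n) : fin n ≠ 0 := by
  rw [Ne, Fin.ext_iff, val_fin, Fin.val_zero]; omega

theorem emp_ne_zero (hn : 3 ≤ n) : emp n ≠ 0 := by
  rw [Ne, Fin.ext_iff, val_emp, Fin.val_zero]; omega

/-- Three distinct elements can be given three distinct names. -/
theorem exists_equiv_of_ne {σ : Type v} {ι : Type*} [DecidableEq ι] (e : σ ≃ ι) {s f z : σ}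
    {a b c : ι} (hsf : s ≠ f) (hsz : s ≠ z) (hfz : f ≠ z) (hab : a ≠ b) (hac : a ≠ c)
    (hbc : b ≠ c) : ∃ e' : σ ≃ ι, e' s = a ∧ e' f = b ∧ e' z = c := by
  let e₁ := e.trans (Equiv.swap (e s) a)
  have h₁ : e₁ s = a := by simp [e₁]
  let e₂ := e₁.trans (Equiv.swap (e₁ f) b)
  have h₂f : e₂ f = b := by simp [e₂]
  have h₂s : e₂ s = a := by
    have : a ≠ e₁ f := h₁ ▸ e₁.injective.ne hsf
    simp [e₂, h₁, Equiv.swap_apply_of_ne_of_ne this hab]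
  let e₃ := e₂.trans (Equiv.swap (e₂ z) c)
  refine ⟨e₃, ?_, ?_, by simp [e₃]⟩
  · have : a ≠ e₂ z := h₂s ▸ e₂.injective.ne hsz
    simp [e₃, h₂s, Equiv.swap_apply_of_ne_of_ne this hac]
  · have : b ≠ e₂ z := h₂f ▸ e₂.injective.ne hfz
    simp [e₃, h₂f, Equiv.swap_apply_of_ne_of_ne this hbc]

theorem exists_isStandardNaming {α : Type u} {σ : Type v} {M : DFA α σ} (hn : 3 ≤ n)
    (hM : IsMinimal M) (hL : IsPrefixFree M.accepts) (hcard : Nat.card σ = n) :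
    ∃ e : σ ≃ Fin n, IsStandardNaming M n e := by
  have := hM.1
  rw [← hcard] at hn
  obtain ⟨f, hf⟩ := exists_mem_accept hM hn
  obtain ⟨z, hz⟩ := exists_acceptsFrom_eq_zero hM hL hn
  have hs := acceptsFrom_start_ne_zero hM hn
  have hsf : M.start ≠ f := fun h => start_notMem_accept hM hL hn (h ▸ hf)
  have hsz : M.start ≠ z := fun h => hs (h ▸ hz)
  have hfz : f ≠ z := by
    rintro rfl
    have : [] ∈ M.acceptsFrom f := hf
    rw [hz] at this
    exact this
  rw [hcard] at hn
  obtain ⟨e, he₁, he₂, he₃⟩ := exists_equiv_of_ne (Finite.equivFinOfCardEq hcard) hsf hsz hfz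
    (fin_ne_zero hn).symm (emp_ne_zero hn).symm (fin_ne_emp hn)
  refine ⟨e, he₁, ?_, ?_⟩
  · have : M.accept = {f} :=
      Set.eq_singleton_iff_unique_mem.2 ⟨hf, fun g hg => mem_accept_unique hM hL hg hf⟩
    rw [this, Set.image_singleton, he₂]
  · rw [← he₃, Equiv.symm_apply_apply, hz]

end Naming

/-! ### Transition semigroups are contained in `Bbf` -/

section Transitions

variable {α : Type u} {σ : Type v} {M : DFA α σ}

theorem exists_word_of_mem_transitions {t : σ → σ} (ht : t ∈ transitions M) :
    ∃ w, w ≠ [] ∧ t = fun q => M.evalFrom q w := by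
  refine Subsemigroup.closure_induction (M := Function.End σ)
    (p := fun t _ => ∃ w, w ≠ [] ∧ t = fun q => M.evalFrom q w) ?_ ?_ ht
  · rintro _ ⟨a, rfl⟩
    exact ⟨[a], by simp, rfl⟩
  · rintro s t _ _ ⟨x, hx, rfl⟩ ⟨y, hy, rfl⟩
    refine ⟨y ++ x, by simp [hx], ?_⟩
    funext q
    exact (DFA.evalFrom_of_append M q y x).symm

theorem comp_mem_conj_transitions {ι : Type*} (e : σ ≃ ι) {s t : ι → ι}
    (hs : s ∈ e.conj '' transitions M) (ht : t ∈ e.conj '' transitions M) :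
    s ∘ t ∈ e.conj '' transitions M := by
  obtain ⟨s, hs, rfl⟩ := hs
  obtain ⟨t, ht, rfl⟩ := ht
  exact ⟨s ∘ t, (transitionSemigroup M).mul_mem' hs ht, e.conj_comp s t⟩

theorem iterate_mem_of_comp_mem {ι : Type*} {T : Set (ι → ι)}
    (hT : ∀ s ∈ T, ∀ t ∈ T, s ∘ t ∈ T) {t : ι → ι} (ht : t ∈ T) :
    ∀ {j : ℕ}, 1 ≤ j → t^[j] ∈ T := by
  intro j hj
  induction j, hj using Nat.le_induction with
  | base => simpa using ht
  | succ j _ ih => rw [Function.iterate_succ]; exact hT _ ih _ ht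

theorem conj_transitions_subset_Bbf {n : ℕ} [NeZero n] (hn : 3 ≤ n) (hM : IsMinimal M)
    (hL : IsBifixFree M.accepts) {e : σ ≃ Fin n} (he : IsStandardNaming M n e) :
    e.conj '' transitions M ⊆ Bbf n := by
  have hcard : Nat.card σ = n := by simpa using Nat.card_congr e
  have hs := acceptsFrom_start_ne_zero hM (hcard.symm ▸ hn)
  have hstart : e.symm 0 = M.start := by rw [← he.start, Equiv.symm_apply_apply]
  have hfin : e.symm (fin n) ∈ M.accept := by
    have h : fin n ∈ e '' M.accept := he.accept ▸ rfl
    obtain ⟨f, hf, h⟩ := h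
    rwa [← h, Equiv.symm_apply_apply]
  have hemp : ∀ {q}, M.acceptsFrom q = 0 → e q = emp n := by
    intro q hq
    rw [← Equiv.eq_symm_apply]
    exact hM.acceptsFrom_injective (hq.trans he.empty.symm)
  have hex : ∀ {q}, e q ≠ emp n → ∃ x, x ∈ M.acceptsFrom q := by
    intro q hq
    by_contra! h
    exact hq (hemp (Set.eq_empty_of_forall_notMem h))
  intro t ht
  -- Powers of `t` belong to the semigroup as well, so the case `j = 1` of the last condition
  -- is enough.
  have hone : ∀ t ∈ e.conj '' transitions M, t 0 = emp n ∨
      ∀ q : Fin n, 0 < (q : ℕ) → (q : ℕ) < n - 1 → t 0 ≠ t q := by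
    rintro _ ⟨t, ht, rfl⟩
    obtain ⟨w, hw, rfl⟩ := exists_word_of_mem_transitions ht
    refine or_iff_not_imp_left.2 fun h0 q hq _ heq => ?_
    simp only [Equiv.conj_apply, hstart] at h0 heq
    have heq := e.injective heq
    obtain ⟨x, hx⟩ := hex h0
    obtain ⟨v, hv⟩ := hM.reachable (e.symm q)
    have h1 : w ++ x ∈ M.accepts := append_mem_accepts.2 hx
    have h2 : v ++ (w ++ x) ∈ M.accepts := by
      rw [append_mem_accepts, hv, append_mem_acceptsFrom, ← heq]
      exact hx
    have h3 : v = [] := by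
      simpa using hL.2 _ h1 _ h2 (List.suffix_append _ _)
    subst h3
    have : q = 0 := by
      rw [← he.start, ← Equiv.symm_apply_eq, ← hv]
      rfl
    rw [this] at hq
    exact absurd hq (by simp)
  refine ⟨?_, ?_, ?_, fun j hj => hone _
    (iterate_mem_of_comp_mem (fun _ hs _ ht => comp_mem_conj_transitions e hs ht) ht hj)⟩
  all_goals
    obtain ⟨t, ht, rfl⟩ := ht
    obtain ⟨w, hw, rfl⟩ := exists_word_of_mem_transitions ht
  · rintro ⟨q, hq⟩
    simp only [Equiv.conj_apply, ← he.start] at hq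
    have hq := e.injective hq
    obtain ⟨v, hv⟩ := hM.reachable (e.symm q)
    obtain ⟨x, hx⟩ := Set.nonempty_iff_ne_empty.2 hs
    have h2 : (v ++ w) ++ x ∈ M.accepts := by
      rw [List.append_assoc, append_mem_accepts, hv, append_mem_acceptsFrom, hq]
      exact hx
    have := hL.2 _ hx _ h2 (List.suffix_append _ _)
    have := congrArg List.length this
    simp only [List.length_append] at this
    exact hw (List.length_eq_zero_iff.1 (by omega))
  · exact hemp (acceptsFrom_evalFrom_eq_zero he.empty w)
  · exact hemp (acceptsFrom_evalFrom_accept hM hL.1 hfin hw)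

end Transitions

/-! ### Realising a semigroup by an automaton -/

section Realisation

variable {n : ℕ} [NeZero n]

/-- The transformation that maps `p` to `q` and everything else to the empty state. -/
def single (p q : Fin n) : Fin n → Fin n := fun x => if x = p then q else emp n

/-- The automaton whose letters are all the elements of `W`. -/
def automaton {α : Type*} {W : Set (Fin n → Fin n)} (g : α ≃ W) : DFA α (Fin n) where
  step q a := (g a).1 q
  start := 0
  accept := {fin n}

theorem exists_evalFrom_automaton {α : Type*} {W : Set (Fin n → Fin n)}
    (hW : ∀ s ∈ W, ∀ t ∈ W, s ∘ t ∈ W) (g : α ≃ W) {w : List α} (hw : w ≠ []) :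
    ∃ t ∈ W, ∀ q, (automaton g).evalFrom q w = t q := by
  induction w with
  | nil => exact absurd rfl hw
  | cons a w ih =>
    by_cases h : w = []
    · subst h
      exact ⟨_, (g a).2, fun q => rfl⟩
    · obtain ⟨t, ht, htw⟩ := ih h
      exact ⟨_, hW t ht _ (g a).2, fun q => htw _⟩

theorem transitions_automaton {α : Type*} {W : Set (Fin n → Fin n)}
    (hW : ∀ s ∈ W, ∀ t ∈ W, s ∘ t ∈ W) (g : α ≃ W) : transitions (automaton g) = W := by
  let S : Subsemigroup (Function.End (Fin n)) := ⟨W, fun {s t} hs ht => hW s hs t ht⟩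
  have hr : Set.range (letterMap (automaton g)) = (S : Set (Function.End (Fin n))) := by
    ext t
    constructor
    · rintro ⟨a, rfl⟩
      exact (g a).2
    · intro ht
      refine ⟨g.symm ⟨t, ht⟩, ?_⟩
      funext q
      simp [letterMap, automaton]
  have h : transitionSemigroup (automaton g) = S := by
    rw [transitionSemigroup, hr, Subsemigroup.closure_eq]
  ext t
  change t ∈ transitionSemigroup (automaton g) ↔ t ∈ W
  rw [h]
  exact Iff.rfl

theorem exists_automaton_of_comp_mem (hn : 3 ≤ n) {W : Set (Fin n → Fin n)} (hB : W ⊆ Bbf n)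
    (hW : ∀ s ∈ W, ∀ t ∈ W, s ∘ t ∈ W) (hstart : ∀ q, q ≠ 0 → single 0 q ∈ W)
    (hfin : ∀ p, p ≠ fin n → p ≠ emp n → single p (fin n) ∈ W) :
    ∃ (k : ℕ) (M : DFA (Fin k) (Fin n)),
      IsMinimal M ∧ IsBifixFree M.accepts ∧ IsStandardNaming M n (Equiv.refl (Fin n)) ∧
        transitions M = W := by
  let g : Fin (Nat.card W) ≃ W := (Finite.equivFin W).symm
  set M := automaton g
  have hletter : ∀ t ∈ W, ∃ a, ∀ q, M.evalFrom q [a] = t q := fun t ht =>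
    ⟨g.symm ⟨t, ht⟩, fun q =>
      congrArg (fun s : W => s.1 q) (g.apply_symm_apply ⟨t, ht⟩)⟩
  have hempty : M.acceptsFrom (emp n) = 0 := by
    ext w
    refine ⟨fun h => ?_, fun h => h.elim⟩
    rw [DFA.mem_acceptsFrom] at h
    rcases eq_or_ne w [] with rfl | hw
    · exact fin_ne_emp hn (Set.mem_singleton_iff.1 h).symm
    · obtain ⟨t, ht, htw⟩ := exists_evalFrom_automaton hW g hw
      rw [htw, (hB ht).2.1] at h
      exact fin_ne_emp hn (Set.mem_singleton_iff.1 h).symm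
  refine ⟨_, M, isMinimal_of_reachable ?_ ?_, ⟨?_, ?_⟩, ⟨rfl, ?_, hempty⟩,
    transitions_automaton hW g⟩
  · intro q
    rcases eq_or_ne q 0 with rfl | hq
    · exact ⟨[], rfl⟩
    · obtain ⟨a, ha⟩ := hletter _ (hstart q hq)
      exact ⟨[a], (ha 0).trans (if_pos rfl)⟩
  · -- The empty word singles out the state `fin n`, and the letter `single p (fin n)` singles
    -- out the state `p`.
    have hne : ∀ p q, p ≠ q → p ≠ emp n → M.acceptsFrom p ≠ M.acceptsFrom q := by
      intro p q hpq hp h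
      rcases eq_or_ne p (fin n) with rfl | hpf
      · have : [] ∈ M.acceptsFrom (fin n) := rfl
        rw [h] at this
        exact hpq (Set.mem_singleton_iff.1 this).symm
      · obtain ⟨a, ha⟩ := hletter _ (hfin p hpf hp)
        have h1 : [a] ∈ M.acceptsFrom p := (ha p).trans (if_pos rfl)
        rw [h, DFA.mem_acceptsFrom, ha q, single, if_neg hpq.symm] at h1
        exact fin_ne_emp hn (Set.mem_singleton_iff.1 h1).symm
    intro p q h
    by_contra hpq
    rcases eq_or_ne p (emp n) with rfl | hp
    · exact hne q _ (Ne.symm hpq) (Ne.symm hpq) h.symm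
    · exact hne p q hpq hp h
  · rintro x hx _ hy ⟨y, rfl⟩
    rw [append_mem_accepts, show M.eval x = fin n from hx, DFA.mem_acceptsFrom] at hy
    rcases eq_or_ne y [] with rfl | hw
    · exact (List.append_nil x).symm
    · obtain ⟨t, ht, htw⟩ := exists_evalFrom_automaton hW g hw
      rw [htw, (hB ht).2.2.1] at hy
      exact absurd (Set.mem_singleton_iff.1 hy).symm (fin_ne_emp hn)
  · rintro y hy _ hxy ⟨x, rfl⟩
    rw [append_mem_accepts, DFA.mem_acceptsFrom] at hxy
    rcases eq_or_ne x [] with rfl | hx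
    · rfl
    rcases eq_or_ne y [] with rfl | hy'
    · exact absurd (Set.mem_singleton_iff.1 hy).symm (fin_ne_zero hn)
    obtain ⟨s, hs, hsx⟩ := exists_evalFrom_automaton hW g hx
    obtain ⟨t, ht, hty⟩ := exists_evalFrom_automaton hW g hy'
    have h0 : t 0 = fin n := (hty 0).symm.trans hy
    have hq : t (s 0) = fin n := by
      rw [hty, show M.eval x = s 0 from hsx 0] at hxy
      exact hxy
    have hs0 : s 0 ≠ 0 := fun h => (hB hs).1 ⟨0, h⟩
    have hse : s 0 ≠ emp n := by
      intro h
      rw [h, (hB ht).2.1] at hq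
      exact fin_ne_emp hn hq.symm
    rcases (hB ht).2.2.2 1 le_rfl with h | h
    · exact absurd (h0.symm.trans h) (fin_ne_emp hn)
    · refine absurd (h0.trans hq.symm) (h (s 0) ?_ ?_)
      · exact Nat.pos_of_ne_zero fun h => hs0 (Fin.ext h)
      · have h1 : (s 0 : ℕ) ≠ n - 1 := fun h => hse (Fin.ext (h.trans val_emp.symm))
        have := (s 0).2
        omega
  · exact Set.image_id _

end Realisation

/-! ### Transformations in `Wge6` and `Wle5` -/

section Transformations

theorem mem_middle {n : ℕ} {q : Fin n} : q ∈ middle n ↔ 1 ≤ (q : ℕ) ∧ (q : ℕ) ≤ n - 3 := Iff.rfl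

variable {n : ℕ} [NeZero n]

theorem eq_emp_iff {q : Fin n} : q = emp n ↔ (q : ℕ) = n - 1 := by
  rw [Fin.ext_iff, val_emp]

theorem eq_fin_iff {q : Fin n} : q = fin n ↔ (q : ℕ) = n - 2 := by
  rw [Fin.ext_iff, val_fin]

theorem eq_zero_iff {q : Fin n} : q = 0 ↔ (q : ℕ) = 0 := by
  rw [Fin.ext_iff, Fin.val_zero]

theorem mem_middle_of_ne {q : Fin n} (h0 : q ≠ 0) (hf : q ≠ fin n) (he : q ≠ emp n) :
    q ∈ middle n := by
  have := q.2
  rw [Ne, eq_zero_iff] at h0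
  rw [Ne, eq_fin_iff] at hf
  rw [Ne, eq_emp_iff] at he
  rw [mem_middle]
  omega

theorem ne_of_mem_middle (hn : 3 ≤ n) {q : Fin n} (h : q ∈ middle n) :
    q ≠ 0 ∧ q ≠ fin n ∧ q ≠ emp n := by
  rw [mem_middle] at h
  rw [Ne, eq_zero_iff, Ne, eq_fin_iff, Ne, eq_emp_iff]
  omega

/-- The part of the definition of `Bbf n` that concerns a single application of `t`. -/
def IsAdmissible (t : Fin n → Fin n) : Prop :=
  (∀ q, t q ≠ 0) ∧ t (emp n) = emp n ∧ t (fin n) = emp n ∧ ∀ q, q ≠ 0 → t 0 = t q → t 0 = emp n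

theorem isAdmissible_of_mem_Bbf {t : Fin n → Fin n} (h : t ∈ Bbf n) : IsAdmissible t := by
  refine ⟨fun q hq => h.1 ⟨q, hq⟩, h.2.1, h.2.2.1, fun q hq heq => ?_⟩
  rcases eq_or_ne q (emp n) with rfl | hqe
  · rw [heq, h.2.1]
  · refine (h.2.2.2 1 le_rfl).resolve_right fun h' => h' q ?_ ?_ heq
    · rw [Ne, eq_zero_iff] at hq
      omega
    · have := q.2
      rw [Ne, eq_emp_iff] at hqe
      omega

theorem iterate_emp {t : Fin n → Fin n} (h : t (emp n) = emp n) (j : ℕ) :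
    t^[j] (emp n) = emp n :=
  Function.iterate_fixed h j

/-- For transformations satisfying the second condition of `Wge6`, the powers of `t` need not
be considered. -/
theorem mem_Wge6_iff {t : Fin n → Fin n} :
    t ∈ Wge6 n ↔ IsAdmissible t ∧
      ((t 0 = fin n ∨ t 0 = emp n) ∨ ∀ q ∈ middle n, t q = fin n ∨ t q = emp n) := by
  constructor
  · rintro ⟨hB, h⟩
    exact ⟨isAdmissible_of_mem_Bbf hB, h.imp_right And.right⟩
  · rintro ⟨hA, h⟩
    refine ⟨⟨fun ⟨q, hq⟩ => hA.1 q hq, hA.2.1, hA.2.2.1, ?_⟩, ?_⟩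
    · intro j hj
      refine or_iff_not_imp_left.2 fun hne q hq _ heq => ?_
      have hq0 : q ≠ 0 := fun h => by simp [h] at hq
      obtain _ | _ | j := j
      · omega
      · exact hne (hA.2.2.2 q hq0 heq)
      · -- The square of `t` maps `0`, or all the other states, to the empty state.
        simp only [Function.iterate_succ, Function.comp_apply] at hne heq
        rcases h with (h | h) | h
        · rw [h, hA.2.2.1] at hne
          exact hne (iterate_emp hA.2.1 j)
        · rw [h, hA.2.1] at hne
          exact hne (iterate_emp hA.2.1 j)
        · have : t (t q) = emp n := by
            by_cases hqf : q = fin n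
            · rw [hqf, hA.2.2.1, hA.2.1]
            by_cases hqe : q = emp n
            · rw [hqe, hA.2.1, hA.2.1]
            rcases h q (mem_middle_of_ne hq0 hqf hqe) with h | h
            · rw [h, hA.2.2.1]
            · rw [h, hA.2.1]
          rw [heq, this] at hne
          exact hne (iterate_emp hA.2.1 j)
    · by_cases h1 : t 0 = fin n
      · exact Or.inl (Or.inl h1)
      by_cases h2 : t 0 = emp n
      · exact Or.inl (Or.inr h2)
      exact Or.inr ⟨mem_middle_of_ne (hA.1 0) h1 h2, h.resolve_left (not_or.2 ⟨h1, h2⟩)⟩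

/-- `t` is injective on the states that are not mapped to the empty state. -/
def InjOffEmpty (t : Fin n → Fin n) : Prop := ∀ p q, t p = t q → p = q ∨ t p = emp n

theorem InjOffEmpty.comp {s t : Fin n → Fin n} (hs : InjOffEmpty s) (ht : InjOffEmpty t)
    (he : s (emp n) = emp n) : InjOffEmpty (s ∘ t) := by
  intro p q h
  rcases hs _ _ h with h | h
  · rcases ht _ _ h with h | h
    · exact Or.inl h
    · exact Or.inr (by rw [Function.comp_apply, h, he])
  · exact Or.inr h

theorem mem_Bbf_of_injOffEmpty {t : Fin n → Fin n} (h0 : ∀ q, t q ≠ 0) (he : t (emp n) = emp n)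
    (hf : t (fin n) = emp n) (h : InjOffEmpty t) : t ∈ Bbf n := by
  refine ⟨fun ⟨q, hq⟩ => h0 q hq, he, hf, fun j _ => ?_⟩
  have hj : InjOffEmpty t^[j] := by
    clear * - he h
    induction j with
    | zero => exact fun p q h => Or.inl h
    | succ j ih => exact ih.comp h (iterate_emp he j)
  refine or_iff_not_imp_left.2 fun hne q hq _ heq => ?_
  rcases hj _ _ heq with h | h
  · simp [← h] at hq
  · exact hne h

theorem mem_Wle5_iff {t : Fin n → Fin n} :
    t ∈ Wle5 n ↔ (∀ q, t q ≠ 0) ∧ t (emp n) = emp n ∧ t (fin n) = emp n ∧ InjOffEmpty t := by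
  constructor
  · rintro ⟨hB, h⟩
    obtain ⟨h0, he, hf, h1⟩ := isAdmissible_of_mem_Bbf hB
    refine ⟨h0, he, hf, fun p q hpq => ?_⟩
    refine or_iff_not_imp_left.2 fun hne => ?_
    by_cases hp0 : p = 0
    · subst hp0
      exact h1 q (Ne.symm hne) hpq
    by_cases hq0 : q = 0
    · subst hq0
      exact hpq.trans (h1 p hne hpq.symm)
    by_cases hpf : p = fin n
    · rw [hpf, hf]
    by_cases hpe : p = emp n
    · rw [hpe, he]
    by_cases hqf : q = fin n
    · rw [hpq, hqf, hf]
    by_cases hqe : q = emp n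
    · rw [hpq, hqe, he]
    rcases h p (mem_middle_of_ne hp0 hpf hpe) q (mem_middle_of_ne hq0 hqf hqe) hne with h | h
    · exact h.1
    · exact absurd hpq h
  · rintro ⟨h0, he, hf, h⟩
    refine ⟨mem_Bbf_of_injOffEmpty h0 he hf h, fun p _ q _ hpq => ?_⟩
    refine or_iff_not_imp_right.2 fun heq => ?_
    have heq := not_not.1 heq
    have h1 := (h p q heq).resolve_left hpq
    exact ⟨h1, heq.symm.trans h1⟩

theorem injOffEmpty_single (p q : Fin n) : InjOffEmpty (single p q) := by
  intro x y h
  unfold single at *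
  grind

theorem single_mem_Wle5 (hn : 3 ≤ n) {p q : Fin n} (hpf : p ≠ fin n) (hpe : p ≠ emp n)
    (hq : q ≠ 0) : single p q ∈ Wle5 n := by
  refine mem_Wle5_iff.2 ⟨fun x => ?_, if_neg hpe.symm, if_neg hpf.symm, injOffEmpty_single p q⟩
  unfold single
  split_ifs
  exacts [hq, emp_ne_zero hn]

theorem single_mem_Wge6 (hn : 3 ≤ n) {p q : Fin n} (hpf : p ≠ fin n) (hpe : p ≠ emp n)
    (hq : q ≠ 0) : single p q ∈ Wge6 n := by
  refine mem_Wge6_iff.2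
    ⟨isAdmissible_of_mem_Bbf (single_mem_Wle5 hn hpf hpe hq).1, ?_⟩
  rcases eq_or_ne p 0 with rfl | hp
  · exact Or.inr fun x hx => Or.inr (if_neg (ne_of_mem_middle hn hx).1)
  · exact Or.inl (Or.inr (if_neg hp.symm))

theorem comp_mem_Wle5 {s t : Fin n → Fin n} (hs : s ∈ Wle5 n) (ht : t ∈ Wle5 n) :
    s ∘ t ∈ Wle5 n := by
  rw [mem_Wle5_iff] at *
  refine ⟨fun q => hs.1 _, ?_, ?_, hs.2.2.2.comp ht.2.2.2 hs.2.1⟩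
  · rw [Function.comp_apply, ht.2.1, hs.2.1]
  · rw [Function.comp_apply, ht.2.2.1, hs.2.1]

theorem comp_mem_Wge6 (hn : 3 ≤ n) {s t : Fin n → Fin n} (hs : s ∈ Wge6 n) (ht : t ∈ Wge6 n) :
    s ∘ t ∈ Wge6 n := by
  rw [mem_Wge6_iff] at *
  obtain ⟨⟨hs0, hse, hsf, hs1⟩, -⟩ := hs
  obtain ⟨⟨ht0, hte, htf, ht1⟩, ht2⟩ := ht
  have hfe : ∀ q, t q = fin n ∨ t q = emp n → s (t q) = emp n := by
    rintro q (h | h) <;> rw [h] <;> assumption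
  have hmid : (∀ q ∈ middle n, t q = fin n ∨ t q = emp n) → ∀ q, q ≠ 0 → s (t q) = emp n := by
    intro h q hq
    by_cases hqf : q = fin n
    · rw [hqf, htf, hse]
    by_cases hqe : q = emp n
    · rw [hqe, hte, hse]
    exact hfe q (h q (mem_middle_of_ne hq hqf hqe))
  simp only [IsAdmissible, Function.comp_apply]
  refine ⟨⟨fun q => hs0 _, by rw [hte, hse], by rw [htf, hse], fun q hq heq => ?_⟩, ?_⟩
  · rcases ht2 with h | h
    · exact hfe 0 h
    · rw [heq, hmid h q hq]
  · rcases ht2 with h | h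
    · exact Or.inl (Or.inr (hfe 0 h))
    · exact Or.inr fun q hq => Or.inr (hmid h q (ne_of_mem_middle hn hq).1)

end Transformations

/-! ### Colliding pairs -/

section Colliding

variable {n : ℕ} [NeZero n] {T : Set (Fin n → Fin n)}

/-- Two middle states `p ≠ q` collide in `T` if some element of `T` maps the initial state to
one of them and a middle state to the other. -/
def Colliding (T : Set (Fin n → Fin n)) (p q : Fin n) : Prop :=
  p ≠ q ∧ p ∈ middle n ∧ q ∈ middle n ∧
    ∃ t ∈ T, ∃ r ∈ middle n, (t 0 = p ∧ t r = q) ∨ (t 0 = q ∧ t r = p)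

theorem Colliding.symm {p q : Fin n} (h : Colliding T p q) : Colliding T q p :=
  ⟨h.1.symm, h.2.2.1, h.2.1, by
    obtain ⟨t, ht, r, hr, h⟩ := h.2.2.2
    exact ⟨t, ht, r, hr, h.symm⟩⟩

/-- The transformations of a semigroup contained in `Bbf n` do not identify two colliding
states, except in the empty state. -/
theorem Colliding.eq_emp (hn : 3 ≤ n) (hB : T ⊆ Bbf n) (hT : ∀ s ∈ T, ∀ t ∈ T, s ∘ t ∈ T)
    {p q : Fin n} (h : Colliding T p q) {s : Fin n → Fin n} (hs : s ∈ T) (heq : s p = s q) :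
    s p = emp n := by
  obtain ⟨-, -, -, t, ht, r, hr, h⟩ := h
  have hst := (isAdmissible_of_mem_Bbf (hB (hT s hs t ht))).2.2.2 r (ne_of_mem_middle hn hr).1
  simp only [Function.comp_apply] at hst
  rcases h with ⟨h0, hr⟩ | ⟨h0, hr⟩
  · rw [h0, hr] at hst
    exact hst heq
  · rw [h0, hr] at hst
    exact heq.trans (hst heq.symm)

theorem colliding_of_apply (hB : T ⊆ Bbf n) {t : Fin n → Fin n} (ht : t ∈ T) {r : Fin n}
    (hr : r ∈ middle n) (hn : 3 ≤ n) (h0 : t 0 ∈ middle n) (htr : t r ∈ middle n) :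
    Colliding T (t 0) (t r) := by
  refine ⟨fun h => ?_, h0, htr, t, ht, r, hr, Or.inl ⟨rfl, rfl⟩⟩
  exact (ne_of_mem_middle hn h0).2.2
    ((isAdmissible_of_mem_Bbf (hB ht)).2.2.2 r (ne_of_mem_middle hn hr).1 h)

theorem subset_Wge6_of_not_colliding (hn : 3 ≤ n) (hB : T ⊆ Bbf n)
    (h : ∀ p q, ¬ Colliding T p q) : T ⊆ Wge6 n := by
  intro t ht
  have hA := isAdmissible_of_mem_Bbf (hB ht)
  refine mem_Wge6_iff.2 ⟨hA, ?_⟩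
  refine or_iff_not_imp_left.2 fun h0 r hr => ?_
  rw [not_or] at h0
  by_contra! hr'
  exact h _ _ (colliding_of_apply hB ht hr hn (mem_middle_of_ne (hA.1 0) h0.1 h0.2)
    (mem_middle_of_ne (hA.1 r) hr'.1 hr'.2))

theorem subset_Wle5_of_colliding (hn : 3 ≤ n) (hB : T ⊆ Bbf n)
    (hT : ∀ s ∈ T, ∀ t ∈ T, s ∘ t ∈ T)
    (h : ∀ p ∈ middle n, ∀ q ∈ middle n, p ≠ q → Colliding T p q) : T ⊆ Wle5 n := by
  intro t ht
  refine ⟨hB ht, fun p hp q hq hpq => or_iff_not_imp_right.2 fun heq => ?_⟩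
  have heq := not_not.1 heq
  have := (h p hp q hq hpq).eq_emp hn hB hT ht heq
  exact ⟨this, heq.symm.trans this⟩

/-- Reduction of the theorem to semigroups contained in `Bbf n`. -/
theorem isUniqueLargest_of_subset_or_ncard_lt (hn : 3 ≤ n) {W : Set (Fin n → Fin n)}
    (hB : W ⊆ Bbf n) (hW : ∀ s ∈ W, ∀ t ∈ W, s ∘ t ∈ W)
    (hsingle : ∀ p q, p ≠ fin n → p ≠ emp n → q ≠ 0 → single p q ∈ W)
    (hmax : ∀ T ⊆ Bbf n, (∀ s ∈ T, ∀ t ∈ T, s ∘ t ∈ T) → T ⊆ W ∨ T.ncard < W.ncard) :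
    IsUniqueLargest.{u, v} n W where
  attained := exists_automaton_of_comp_mem hn hB hW
    (fun q hq => hsingle 0 q (fin_ne_zero hn).symm (emp_ne_zero hn).symm hq)
    (fun p hp hp' => hsingle p _ hp hp' (fin_ne_zero hn))
  naming := fun _ _ _ _ hM hL hcard => exists_isStandardNaming hn hM hL.1 hcard
  largest := fun _ _ _ M hM hL hcard => by
    obtain ⟨e, he⟩ := exists_isStandardNaming hn hM hL.1 hcard
    rw [← Set.ncard_image_of_injective (transitions M) e.conj.injective]
    rcases hmax _ (conj_transitions_subset_Bbf hn hM hL he)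
      (fun s hs t ht => comp_mem_conj_transitions e hs ht) with h | h
    · exact Set.ncard_le_ncard h (Set.toFinite _)
    · exact h.le
  unique := fun _ _ _ M hM hL _ heq e he => by
    rw [← Set.ncard_image_of_injective (transitions M) e.conj.injective] at heq
    rcases hmax _ (conj_transitions_subset_Bbf hn hM hL he)
      (fun s hs t ht => comp_mem_conj_transitions e hs ht) with h | h
    · exact Set.eq_of_subset_of_ncard_le h heq.ge (Set.toFinite _)
    · omega

theorem isUniqueLargest_Wge6 (hn : 3 ≤ n)
    (hmax : ∀ T ⊆ Bbf n, (∀ s ∈ T, ∀ t ∈ T, s ∘ t ∈ T) → T ⊆ Wge6 n ∨ T.ncard < (Wge6 n).ncard) :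
    IsUniqueLargest.{u, v} n (Wge6 n) :=
  isUniqueLargest_of_subset_or_ncard_lt hn (fun _ h => h.1)
    (fun _ hs _ ht => comp_mem_Wge6 hn hs ht) (fun _ _ hp hp' hq => single_mem_Wge6 hn hp hp' hq)
    hmax

theorem isUniqueLargest_Wle5 (hn : 3 ≤ n)
    (hmax : ∀ T ⊆ Bbf n, (∀ s ∈ T, ∀ t ∈ T, s ∘ t ∈ T) → T ⊆ Wle5 n ∨ T.ncard < (Wle5 n).ncard) :
    IsUniqueLargest.{u, v} n (Wle5 n) :=
  isUniqueLargest_of_subset_or_ncard_lt hn (fun _ h => h.1)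
    (fun _ hs _ ht => comp_mem_Wle5 hs ht) (fun _ _ hp hp' hq => single_mem_Wle5 hn hp hp' hq)
    hmax

/-! ### At most one middle state -/

/-- With at most one middle state no two states collide. -/
theorem Bbf_subset_Wge6 (hn : 3 ≤ n) (hn' : n ≤ 4) : Bbf n ⊆ Wge6 n := by
  refine subset_Wge6_of_not_colliding hn subset_rfl fun p q h => h.1 ?_
  have hp := mem_middle.1 h.2.1
  have hq := mem_middle.1 h.2.2.1
  exact Fin.ext (by omega)

theorem Bbf_subset_Wle5 (hn' : n ≤ 4) : Bbf n ⊆ Wle5 n := by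
  refine fun t ht => ⟨ht, fun p hp q hq hpq => absurd (Fin.ext ?_) hpq⟩
  rw [mem_middle] at hp hq
  omega

theorem Wge6_eq_Wle5 (hn : 3 ≤ n) (hn' : n ≤ 4) : Wge6 n = Wle5 n :=
  Set.Subset.antisymm (fun _ h => Bbf_subset_Wle5 hn' h.1) fun _ h => Bbf_subset_Wge6 hn hn' h.1

end Colliding

/-! ### Sizes of `Wge6` and `Wle5` -/

section Sizes

variable {m : ℕ}

/-- The transformation with `0 ↦ z`, `i + 1 ↦ f i` for `i < m`, and the last two states mapped
to the empty state. -/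
def extend (z : Fin (m + 3)) (f : Fin m → Fin (m + 3)) : Fin (m + 3) → Fin (m + 3) :=
  Fin.cons z (Fin.append f fun _ : Fin 2 => emp (m + 3))

theorem extend_zero (z : Fin (m + 3)) (f : Fin m → Fin (m + 3)) : extend z f 0 = z := rfl

theorem extend_succ (z : Fin (m + 3)) (f : Fin m → Fin (m + 3)) (i : Fin m) :
    extend z f (Fin.castAdd 2 i).succ = f i := by
  simp [extend]

theorem extend_natAdd (z : Fin (m + 3)) (f : Fin m → Fin (m + 3)) (i : Fin 2) :
    extend z f (Fin.natAdd m i).succ = emp (m + 3) := by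
  simp [extend]

theorem extend_fin (z : Fin (m + 3)) (f : Fin m → Fin (m + 3)) :
    extend z f (fin (m + 3)) = emp (m + 3) := by
  convert extend_natAdd z f 0
  rw [Fin.ext_iff, val_fin]
  simp

theorem extend_emp (z : Fin (m + 3)) (f : Fin m → Fin (m + 3)) :
    extend z f (emp (m + 3)) = emp (m + 3) := by
  convert extend_natAdd z f 1
  rw [Fin.ext_iff, val_emp]
  simp

/-- To check a property of all values of `extend z f` it is enough to consider the values `z`,
`f i`, and the empty state. -/
theorem forall_extend {z : Fin (m + 3)} {f : Fin m → Fin (m + 3)}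
    {P : Fin (m + 3) → Fin (m + 3) → Prop} (h0 : P 0 z)
    (h1 : ∀ i, P (Fin.castAdd 2 i).succ (f i))
    (h2 : ∀ i, P (Fin.natAdd m i).succ (emp (m + 3))) (q : Fin (m + 3)) : P q (extend z f q) := by
  refine Fin.cases ?_ (fun i => ?_) q
  · exact h0
  · refine Fin.addCases (fun i => ?_) (fun i => ?_) i
    · rw [extend_succ]; exact h1 i
    · rw [extend_natAdd]; exact h2 i

theorem extend_injective :
    Function.Injective fun x : (_ : Fin (m + 3)) × (Fin m → Fin (m + 3)) => extend x.1 x.2 := by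
  rintro ⟨z, f⟩ ⟨z', f'⟩ h
  have h0 : z = z' := congrFun h 0
  have h1 : f = f' := by
    funext i
    have := congrFun h (Fin.castAdd 2 i).succ
    simpa only [extend_succ] using this
  rw [h0, h1]

/-- The values that an element of `Wge6` with `0 ↦ z` may take at the middle states. -/
def middleValues (z : Fin (m + 3)) : Finset (Fin (m + 3)) :=
  if z = emp (m + 3) then {0}ᶜ
  else if z = fin (m + 3) then {0, fin (m + 3)}ᶜ
  else if z = 0 then ∅
  else {fin (m + 3), emp (m + 3)}

theorem extend_mem_Wge6 {z : Fin (m + 3)} (hz : z ≠ 0) {f : Fin m → Fin (m + 3)}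
    (hf : ∀ i, f i ∈ middleValues z) : extend z f ∈ Wge6 (m + 3) := by
  have hn : 3 ≤ m + 3 := by omega
  have hfz : ∀ i, f i ≠ 0 ∧ (z = f i → z = emp (m + 3)) := by
    intro i
    have := hf i
    unfold middleValues at this
    split_ifs at this with h1 h2
    · simpa [h1] using this
    · simp only [Finset.compl_insert, Finset.mem_erase, Finset.mem_compl,
        Finset.mem_singleton] at this
      exact ⟨this.1, fun h => absurd (h.symm.trans h2) this.2⟩
    · simp only [Finset.mem_insert, Finset.mem_singleton] at this
      rcases this with h | h <;> rw [h]
      · exact ⟨fin_ne_zero hn, fun h' => absurd h' h2⟩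
      · exact ⟨emp_ne_zero hn, id⟩
  refine mem_Wge6_iff.2 ⟨⟨?_, extend_emp z f, extend_fin z f, ?_⟩, ?_⟩
  · exact forall_extend (P := fun _ y => y ≠ 0) hz (fun i => (hfz i).1)
      fun _ => emp_ne_zero hn
  · rw [extend_zero]
    exact forall_extend (P := fun q y => q ≠ 0 → z = y → z = emp (m + 3))
      (fun h => absurd rfl h) (fun i _ => (hfz i).2) fun _ _ => id
  · rw [extend_zero]
    refine or_iff_not_imp_left.2 fun h => ?_
    rw [not_or] at h
    refine forall_extend (P := fun q y => q ∈ middle (m + 3) →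
      y = fin (m + 3) ∨ y = emp (m + 3)) (fun h => ?_) (fun i _ => ?_) fun _ _ => Or.inr rfl
    · exact absurd rfl (ne_of_mem_middle hn h).1
    · have := hf i
      rw [middleValues, if_neg h.2, if_neg h.1, if_neg hz] at this
      simpa using this

/-- The sum is `(n-1)^(n-3) + (n-2)^(n-3) + (n-3) 2^(n-3)`, where `n = m + 3`. -/
theorem sum_card_middleValues_le_ncard_Wge6 (hm : m ≠ 0) :
    ∑ z : Fin (m + 3), (middleValues z).card ^ m ≤ (Wge6 (m + 3)).ncard := by
  let S : Finset ((_ : Fin (m + 3)) × (Fin m → Fin (m + 3))) :=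
    Finset.univ.sigma fun z => Fintype.piFinset fun _ => middleValues z
  have hS : S.card = ∑ z : Fin (m + 3), (middleValues z).card ^ m := by
    simp [S, Finset.card_sigma]
  rw [← hS, ← Set.ncard_coe_finset]
  refine Set.ncard_le_ncard_of_injOn (fun x => extend x.1 x.2) ?_ extend_injective.injOn
    (Set.toFinite _)
  rintro ⟨z, f⟩ h
  have h : ∀ i, f i ∈ middleValues z := by simpa [S] using h
  refine extend_mem_Wge6 ?_ h
  rintro rfl
  have := h ⟨0, Nat.pos_of_ne_zero hm⟩
  have hn : 3 ≤ m + 3 := by omega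
  rw [middleValues, if_neg (emp_ne_zero hn).symm, if_neg (fin_ne_zero hn).symm,
    if_pos rfl] at this
  exact absurd this (Finset.notMem_empty _)

theorem le_ncard_Wge6_six : 213 ≤ (Wge6 6).ncard :=
  le_of_eq_of_le (by decide) (sum_card_middleValues_le_ncard_Wge6 (m := 3) (by decide))

theorem le_ncard_Wge6_seven : 1985 ≤ (Wge6 7).ncard :=
  le_of_eq_of_le (by decide) (sum_card_middleValues_le_ncard_Wge6 (m := 4) (by decide))

/-- The values at `0`, `1`, `2` of the elements of `Wle5 5`: those with pairwise different values
other than the empty state `4`. -/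
def injOffEmptyTriples : Finset (Fin 5 × Fin 5 × Fin 5) :=
  {x | ∀ p q, ![x.1, x.2.1, x.2.2, 4, 4] p ≠ 0 ∧
    (![x.1, x.2.1, x.2.2, 4, 4] p = ![x.1, x.2.1, x.2.2, 4, 4] q →
      p = q ∨ ![x.1, x.2.1, x.2.2, 4, 4] p = 4)}

theorem card_injOffEmptyTriples : injOffEmptyTriples.card = 34 := by decide +kernel

theorem le_ncard_Wle5_five : 34 ≤ (Wle5 5).ncard := by
  rw [← card_injOffEmptyTriples, ← Set.ncard_coe_finset]
  refine Set.ncard_le_ncard_of_injOn (fun x => ![x.1, x.2.1, x.2.2, 4, 4]) ?_ ?_ (Set.toFinite _)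
  · intro x hx
    have hx := (Finset.mem_filter.1 hx).2
    exact mem_Wle5_iff.2 ⟨fun q => (hx q q).1, rfl, rfl, fun p q => (hx p q).2⟩
  · intro x _ y _ h
    exact Prod.ext (congrFun h 0) (Prod.ext (congrFun h 1) (congrFun h 2))

end Sizes

/-! ### Counting the transformations compatible with a set of colliding pairs -/

section Counting

/-- The list `[k, …, 2, 1]`. -/
def down : ℕ → List ℕ
  | 0 => []
  | k + 1 => (k + 1) :: down k

theorem mem_down {i k : ℕ} : i ∈ down k ↔ 1 ≤ i ∧ i ≤ k := by
  induction k with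
  | zero => simp [down]; omega
  | succ k ih => simp [down, ih]; omega

/-- For a state with image `x` and states with images `ys`, where the Booleans tell which of the
latter collide with the former: no colliding pair is identified outside the state `e`. -/
def unfocused (e x : ℕ) : List Bool → List ℕ → Bool
  | b :: bs, y :: ys => (!b || !Nat.beq x y || Nat.beq x e) && unfocused e x bs ys
  | _, _ => true

theorem beq_eq_false {a b : ℕ} (h : a ≠ b) : Nat.beq a b = false :=
  Bool.eq_false_iff.2 fun h' => h (Nat.eq_of_beq_eq_true h')

theorem unfocused_map {e x : ℕ} {g : ℕ → Bool} {f : ℕ → ℕ} {l : List ℕ}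
    (h : ∀ i ∈ l, g i = true → x = f i → x = e) : unfocused e x (l.map g) (l.map f) = true := by
  induction l with
  | nil => rfl
  | cons i l ih =>
    have h1 := h i List.mem_cons_self
    have h2 := ih fun i hi => h i (List.mem_cons_of_mem _ hi)
    simp only [List.map_cons, unfocused, h2, Bool.and_true]
    cases hg : g i
    · rfl
    · by_cases hx : x = f i
      · simp [h1 hg hx]
      · simp [beq_eq_false hx]

/-- Given a graph by the adjacency lists of its vertices to earlier vertices (latest vertex
first), the maps of its vertices to `A` that identify no two adjacent vertices outside `e`. -/
def assignments (e : ℕ) (A : List ℕ) : List (List Bool) → List (List ℕ)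
  | [] => [[]]
  | r :: rs => (assignments e A rs).flatMap fun ys =>
      (A.filter fun x => unfocused e x r ys).map (· :: ys)

/-- The number of assignments, computed without listing the values at the last vertex. -/
def numAssignments (e : ℕ) (A : List ℕ) : List (List Bool) → ℕ
  | [] => 1
  | r :: rs => ((assignments e A rs).map fun ys =>
      (A.filter fun x => unfocused e x r ys).length).sum

theorem length_assignments (e : ℕ) (A : List ℕ) (rs : List (List Bool)) :
    (assignments e A rs).length = numAssignments e A rs := by
  cases rs with
  | nil => rfl
  | cons r rs => simp [assignments, numAssignments, List.length_flatMap]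

/-- The adjacency lists of the graph `c` on `1, …, k`. -/
def rows (c : ℕ → ℕ → Bool) : ℕ → List (List Bool)
  | 0 => []
  | k + 1 => (down k).map (c (k + 1)) :: rows c k

theorem map_mem_assignments {e : ℕ} {A : List ℕ} {c : ℕ → ℕ → Bool} {f : ℕ → ℕ} {k : ℕ}
    (hA : ∀ i, 1 ≤ i → i ≤ k → f i ∈ A)
    (hc : ∀ i j, 1 ≤ i → i < j → j ≤ k → c j i = true → f j = f i → f j = e) :
    (down k).map f ∈ assignments e A (rows c k) := by
  induction k with
  | zero => simp [down, assignments, rows]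
  | succ k ih =>
    simp only [assignments, rows, down, List.map_cons, List.mem_flatMap]
    refine ⟨_, ih (fun i h1 h2 => hA i h1 (by omega))
      (fun i j h1 h2 h3 => hc i j h1 h2 (by omega)), ?_⟩
    refine List.mem_map.2 ⟨_, List.mem_filter.2 ⟨hA (k + 1) (by omega) le_rfl, ?_⟩, rfl⟩
    refine unfocused_map fun i hi => ?_
    rw [mem_down] at hi
    exact hc i _ hi.1 (by omega) le_rfl

/-- The possible images of a middle state under a transformation that maps `0` to `z`, if `c`
is the graph of colliding pairs. -/
def images (c : ℕ → ℕ → Bool) (m z : ℕ) : List ℕ :=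
  if z = m + 2 then down (m + 2)
  else if z = m + 1 then (m + 2) :: down m
  else (m + 2) :: (m + 1) :: (down m).filter fun q => !Nat.beq q z && c (max q z) (min q z)

/-- An upper bound on the size of a semigroup on `m + 3` states whose colliding pairs form the
graph `c`. -/
def bound (c : ℕ → ℕ → Bool) (m : ℕ) : ℕ :=
  ((down (m + 2)).map fun z => numAssignments (m + 2) (images c m z) (rows c m)).sum

variable {m : ℕ} {T : Set (Fin (m + 3) → Fin (m + 3))} {c : ℕ → ℕ → Bool}

/-- The graph `c` describes the pairs that collide in `T`; only its values at arguments in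
decreasing order matter. -/
def IsCollisionGraph (T : Set (Fin (m + 3) → Fin (m + 3))) (c : ℕ → ℕ → Bool) : Prop :=
  ∀ p q : Fin (m + 3), p ∈ middle (m + 3) → q ∈ middle (m + 3) → q < p →
    (c p q = true ↔ Colliding T p q)

theorem val_apply_mem_images (hB : T ⊆ Bbf (m + 3)) (hc : IsCollisionGraph T c)
    {t : Fin (m + 3) → Fin (m + 3)} (ht : t ∈ T) {r : Fin (m + 3)} (hr : r ∈ middle (m + 3)) :
    (t r : ℕ) ∈ images c m (t 0) := by
  have hn : 3 ≤ m + 3 := by omega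
  obtain ⟨h0, -, -, h1⟩ := isAdmissible_of_mem_Bbf (hB ht)
  have hpos := h0 r
  have hlt := (t r).2
  have h1 := h1 r (ne_of_mem_middle hn hr).1
  rw [Ne, eq_zero_iff] at hpos
  rw [Fin.ext_iff, eq_emp_iff] at h1
  unfold images
  split_ifs with h2 h3
  · rw [mem_down]; omega
  · rw [List.mem_cons, mem_down]; omega
  · have hz : t 0 ∈ middle (m + 3) := by
      refine mem_middle_of_ne (h0 0) ?_ ?_
      · rw [Ne, eq_fin_iff]; omega
      · rw [Ne, eq_emp_iff]; omega
    by_cases hE : (t r : ℕ) = m + 2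
    · simp [hE]
    by_cases hF : (t r : ℕ) = m + 1
    · simp [hF]
    have htr : t r ∈ middle (m + 3) := by
      rw [mem_middle]; omega
    have hcol := colliding_of_apply hB ht hr hn hz htr
    refine List.mem_cons_of_mem _ (List.mem_cons_of_mem _ (List.mem_filter.2 ⟨?_, ?_⟩))
    · rw [mem_down]; omega
    · have hne : (t r : ℕ) ≠ t 0 := fun h => hcol.1 (Fin.ext h.symm)
      have hcc : c (max (t r : ℕ) (t 0)) (min (t r : ℕ) (t 0)) = true := by
        rcases lt_or_gt_of_ne hne with h | h
        · rw [max_eq_right h.le, min_eq_left h.le]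
          exact (hc _ _ hz htr h).2 hcol
        · rw [max_eq_left h.le, min_eq_right h.le]
          exact (hc _ _ htr hz h).2 hcol.symm
      simp [beq_eq_false hne, hcc]

theorem ncard_le_bound (hB : T ⊆ Bbf (m + 3)) (hT : ∀ s ∈ T, ∀ t ∈ T, s ∘ t ∈ T)
    (hc : IsCollisionGraph T c) : T.ncard ≤ bound c m := by
  have hn : 3 ≤ m + 3 := by omega
  let f (t : Fin (m + 3) → Fin (m + 3)) (i : ℕ) : ℕ := t (Fin.ofNat (m + 3) i)
  let L : List (List ℕ) := (down (m + 2)).flatMap fun z =>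
    (assignments (m + 2) (images c m z) (rows c m)).map (z :: ·)
  have hL : L.length = bound c m := by
    simp [L, bound, List.length_flatMap, length_assignments]
  have hval : ∀ i, i < m + 3 → (Fin.ofNat (m + 3) i : ℕ) = i := fun i hi => Nat.mod_eq_of_lt hi
  have hmid : ∀ i, 1 ≤ i → i ≤ m → Fin.ofNat (m + 3) i ∈ middle (m + 3) := fun i h1 h2 => by
    rw [mem_middle, hval i (by omega)]
    omega
  rw [← hL]
  refine le_trans ?_ (List.toFinset_card_le L)
  rw [← Set.ncard_coe_finset]
  refine Set.ncard_le_ncard_of_injOn (fun t => f t 0 :: (down m).map (f t)) ?_ ?_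
    (Set.toFinite _)
  · intro t ht
    have h0 := (isAdmissible_of_mem_Bbf (hB ht)).1 0
    rw [Ne, eq_zero_iff] at h0
    have h1 := (t 0).2
    have hL' : f t 0 :: (down m).map (f t) ∈ L := by
      refine List.mem_flatMap.2 ⟨f t 0, ?_, List.mem_map.2 ⟨_, map_mem_assignments ?_ ?_, rfl⟩⟩
      · rw [mem_down]
        change 1 ≤ (t 0 : ℕ) ∧ (t 0 : ℕ) ≤ m + 2
        omega
      · exact fun i h1 h2 => val_apply_mem_images hB hc ht (hmid i h1 h2)
      · intro i j h1 h2 h3 hcij heq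
        have hcol : Colliding T (Fin.ofNat (m + 3) j) (Fin.ofNat (m + 3) i) := by
          refine (hc _ _ (hmid j (by omega) h3) (hmid i h1 (by omega)) ?_).1 ?_
          · rw [Fin.lt_def, hval i (by omega), hval j (by omega)]
            exact h2
          · rwa [hval i (by omega), hval j (by omega)]
        exact eq_emp_iff.1 (hcol.eq_emp hn hB hT ht (Fin.ext heq))
    simpa using hL'
  · intro s hs t ht hst
    have hs := isAdmissible_of_mem_Bbf (hB hs)
    have ht := isAdmissible_of_mem_Bbf (hB ht)
    obtain ⟨h0, h1⟩ := List.cons.inj hst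
    rw [List.map_inj_left] at h1
    funext q
    by_cases hq0 : q = 0
    · rw [hq0]
      exact Fin.ext h0
    by_cases hqf : q = fin (m + 3)
    · rw [hqf, hs.2.2.1, ht.2.2.1]
    by_cases hqe : q = emp (m + 3)
    · rw [hqe, hs.2.1, ht.2.1]
    have hq := mem_middle.1 (mem_middle_of_ne hq0 hqf hqe)
    have := h1 q (mem_down.2 (by omega))
    have hqq : Fin.ofNat (m + 3) q = q := Fin.ext (hval _ q.2)
    simp only [f, hqq] at this
    exact Fin.ext this

end Counting

/-! ### Two, three and four middle states -/

section SmallCases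

/-- The graph on `1, 2, 3, 4` given by its adjacency matrix below the diagonal. -/
def graph (c₂₁ c₃₁ c₃₂ c₄₁ c₄₂ c₄₃ : Bool) : ℕ → ℕ → Bool
  | 2, 1 => c₂₁
  | 3, 1 => c₃₁
  | 3, 2 => c₃₂
  | 4, 1 => c₄₁
  | 4, 2 => c₄₂
  | 4, 3 => c₄₃
  | _, _ => false

/-- The numbers marked with `true`. -/
def marked : List (Bool × ℕ) → List ℕ
  | [] => []
  | (b, x) :: l => bif b then x :: marked l else marked l

section

variable (a b c d e f : Bool)

theorem rows_graph_four : rows (graph a b c d e f) 4 = [[f, e, d], [c, b], [a], []] := rfl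

theorem images_graph_four_one :
    images (graph a b c d e f) 4 1 = 6 :: 5 :: marked [(d, 4), (b, 3), (a, 2)] := by
  cases a <;> cases b <;> cases d <;> rfl

theorem images_graph_four_two :
    images (graph a b c d e f) 4 2 = 6 :: 5 :: marked [(e, 4), (c, 3), (a, 1)] := by
  cases a <;> cases c <;> cases e <;> rfl

theorem images_graph_four_three :
    images (graph a b c d e f) 4 3 = 6 :: 5 :: marked [(f, 4), (c, 2), (b, 1)] := by
  cases b <;> cases c <;> cases f <;> rfl

theorem images_graph_four_four :
    images (graph a b c d e f) 4 4 = 6 :: 5 :: marked [(f, 3), (e, 2), (d, 1)] := by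
  cases d <;> cases e <;> cases f <;> rfl

/-- The summands of `bound`, with all lists written out so that they can be evaluated fast. -/
theorem bound_graph_four :
    bound (graph a b c d e f) 4 =
      numAssignments 6 [6, 5, 4, 3, 2, 1] [[f, e, d], [c, b], [a], []] +
      (numAssignments 6 [6, 4, 3, 2, 1] [[f, e, d], [c, b], [a], []] +
      (numAssignments 6 (6 :: 5 :: marked [(f, 3), (e, 2), (d, 1)])
        [[f, e, d], [c, b], [a], []] +
      (numAssignments 6 (6 :: 5 :: marked [(f, 4), (c, 2), (b, 1)])
        [[f, e, d], [c, b], [a], []] +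
      (numAssignments 6 (6 :: 5 :: marked [(e, 4), (c, 3), (a, 1)])
        [[f, e, d], [c, b], [a], []] +
      (numAssignments 6 (6 :: 5 :: marked [(d, 4), (b, 3), (a, 2)])
        [[f, e, d], [c, b], [a], []] + 0))))) := by
  rw [← images_graph_four_one a b c d e f, ← images_graph_four_two a b c d e f,
    ← images_graph_four_three a b c d e f, ← images_graph_four_four a b c d e f,
    ← rows_graph_four]
  rfl

end

theorem bound_graph_four_lt : ∀ a b c d e f : Bool, a || b || c || d || e || f →
    bound (graph a b c d e f) 4 < 1985 := by
  simp only [bound_graph_four]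
  decide +kernel

theorem bound_graph_three_lt : ∀ a b c : Bool, a || b || c →
    bound (graph a b c false false false) 3 < 213 := by
  decide +kernel

theorem bound_two_le : bound (fun _ _ => false) 2 ≤ 33 := by decide +kernel

open Classical in
/-- The graph of colliding pairs, for three middle states. -/
theorem isCollisionGraph_graph_three (T : Set (Fin 6 → Fin 6)) :
    IsCollisionGraph (m := 3) T (graph (decide (Colliding T 2 1)) (decide (Colliding T 3 1))
      (decide (Colliding T 3 2)) false false false) := by
  intro p q hp hq hqp
  rw [mem_middle] at hp hq
  obtain ⟨p, hp'⟩ := p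
  obtain ⟨q, hq'⟩ := q
  simp only [Fin.lt_def] at hp hq hqp
  interval_cases p <;> interval_cases q <;> first | omega | exact decide_eq_true_iff

open Classical in
/-- The graph of colliding pairs, for four middle states. -/
theorem isCollisionGraph_graph_four (T : Set (Fin 7 → Fin 7)) :
    IsCollisionGraph (m := 4) T (graph (decide (Colliding T 2 1)) (decide (Colliding T 3 1))
      (decide (Colliding T 3 2)) (decide (Colliding T 4 1)) (decide (Colliding T 4 2))
      (decide (Colliding T 4 3))) := by
  intro p q hp hq hqp
  rw [mem_middle] at hp hq
  obtain ⟨p, hp'⟩ := p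
  obtain ⟨q, hq'⟩ := q
  simp only [Fin.lt_def] at hp hq hqp
  interval_cases p <;> interval_cases q <;> first | omega | exact decide_eq_true_iff

/-- A graph without edges describes only a set without colliding pairs. -/
theorem IsCollisionGraph.not_colliding {m : ℕ} {T : Set (Fin (m + 3) → Fin (m + 3))}
    {c : ℕ → ℕ → Bool} (hc : IsCollisionGraph T c) (h : ∀ p q, c p q = false)
    (p q : Fin (m + 3)) : ¬ Colliding T p q := by
  intro hcol
  rcases lt_or_gt_of_ne hcol.1 with hlt | hlt
  · simpa [h] using (hc q p hcol.2.2.1 hcol.2.1 hlt).2 hcol.symm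
  · simpa [h] using (hc p q hcol.2.1 hcol.2.2.1 hlt).2 hcol

theorem graph_false : ∀ p q, graph false false false false false false p q = false := by
  intro p q
  unfold graph
  split <;> rfl

theorem subset_or_ncard_lt_six {T : Set (Fin 6 → Fin 6)} (hB : T ⊆ Bbf 6)
    (hT : ∀ s ∈ T, ∀ t ∈ T, s ∘ t ∈ T) : T ⊆ Wge6 6 ∨ T.ncard < (Wge6 6).ncard := by
  classical
  have hc := isCollisionGraph_graph_three T
  generalize decide (Colliding T 2 1) = c₂₁, decide (Colliding T 3 1) = c₃₁,
    decide (Colliding T 3 2) = c₃₂ at hc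
  by_cases h : (c₂₁ || c₃₁ || c₃₂) = true
  · exact Or.inr ((ncard_le_bound hB hT hc).trans_lt
      ((bound_graph_three_lt _ _ _ h).trans_le le_ncard_Wge6_six))
  · simp only [Bool.not_eq_true, Bool.or_eq_false_iff] at h
    obtain ⟨⟨rfl, rfl⟩, rfl⟩ := h
    exact Or.inl (subset_Wge6_of_not_colliding (by decide) hB (hc.not_colliding graph_false))

theorem subset_or_ncard_lt_seven {T : Set (Fin 7 → Fin 7)} (hB : T ⊆ Bbf 7)
    (hT : ∀ s ∈ T, ∀ t ∈ T, s ∘ t ∈ T) : T ⊆ Wge6 7 ∨ T.ncard < (Wge6 7).ncard := by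
  classical
  have hc := isCollisionGraph_graph_four T
  generalize decide (Colliding T 2 1) = c₂₁, decide (Colliding T 3 1) = c₃₁,
    decide (Colliding T 3 2) = c₃₂, decide (Colliding T 4 1) = c₄₁,
    decide (Colliding T 4 2) = c₄₂, decide (Colliding T 4 3) = c₄₃ at hc
  by_cases h : (c₂₁ || c₃₁ || c₃₂ || c₄₁ || c₄₂ || c₄₃) = true
  · exact Or.inr ((ncard_le_bound hB hT hc).trans_lt
      ((bound_graph_four_lt _ _ _ _ _ _ h).trans_le le_ncard_Wge6_seven))
  · simp only [Bool.not_eq_true, Bool.or_eq_false_iff] at h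
    obtain ⟨⟨⟨⟨⟨rfl, rfl⟩, rfl⟩, rfl⟩, rfl⟩, rfl⟩ := h
    exact Or.inl (subset_Wge6_of_not_colliding (by decide) hB (hc.not_colliding graph_false))

theorem subset_or_ncard_lt_five {T : Set (Fin 5 → Fin 5)} (hB : T ⊆ Bbf 5)
    (hT : ∀ s ∈ T, ∀ t ∈ T, s ∘ t ∈ T) : T ⊆ Wle5 5 ∨ T.ncard < (Wle5 5).ncard := by
  by_cases h : Colliding T 2 1
  · refine Or.inl (subset_Wle5_of_colliding (by decide) hB hT fun p hp q hq hpq => ?_)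
    have : (p = 1 ∧ q = 2) ∨ (p = 2 ∧ q = 1) := by
      rw [mem_middle] at hp hq
      simp only [Fin.ext_iff, Fin.val_one, Fin.val_two, Ne] at hpq ⊢
      omega
    rcases this with ⟨rfl, rfl⟩ | ⟨rfl, rfl⟩
    exacts [h.symm, h]
  · refine Or.inr ((ncard_le_bound (m := 2) (c := fun _ _ => false) hB hT ?_).trans_lt
      (lt_of_le_of_lt bound_two_le le_ncard_Wle5_five))
    intro p q hp hq hqp
    have : p = 2 ∧ q = 1 := by
      rw [mem_middle] at hp hq
      simp only [Fin.ext_iff, Fin.val_one, Fin.val_two, Fin.lt_def] at hqp ⊢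
      omega
    rw [this.1, this.2]
    simpa using h

end SmallCases

end BifixFree


theorem mainTheorem7 :
    BifixFree.IsUniqueLargest.{u, v} 6 (BifixFree.Wge6 6) ∧
    BifixFree.IsUniqueLargest.{u, v} 7 (BifixFree.Wge6 7) ∧
    BifixFree.IsUniqueLargest.{u, v} 5 (BifixFree.Wle5 5) ∧
    (BifixFree.Wge6 3 = BifixFree.Wle5 3 ∧
      BifixFree.IsUniqueLargest.{u, v} 3 (BifixFree.Wge6 3)) ∧
    (BifixFree.Wge6 4 = BifixFree.Wle5 4 ∧
      BifixFree.IsUniqueLargest.{u, v} 4 (BifixFree.Wge6 4)) := by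
  refine ⟨BifixFree.isUniqueLargest_Wge6 (by decide) fun T => BifixFree.subset_or_ncard_lt_six,
    BifixFree.isUniqueLargest_Wge6 (by decide) fun T => BifixFree.subset_or_ncard_lt_seven,
    BifixFree.isUniqueLargest_Wle5 (by decide) fun T => BifixFree.subset_or_ncard_lt_five,
    ⟨BifixFree.Wge6_eq_Wle5 (by decide) (by decide), ?_⟩,
    ⟨BifixFree.Wge6_eq_Wle5 (by decide) (by decide), ?_⟩⟩ <;>
  exact BifixFree.isUniqueLargest_Wge6 (by decide) fun T hB _ =>
    Or.inl (hB.trans (BifixFree.Bbf_subset_Wge6 (by decide) (by decide)))
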